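/- Let $n$ and $\Delta$ be integers with $2<\Delta<n-1$, and let $\mathcal{T}_n^{\Delta}$ be the set of trees on $n$ vertices with maximum degree $\Delta$. For an edge $e=uv$ of a tree $T$ on $n$ vertices, let $n_u(e)$ and $n_v(e)$ be the numbers of vertices of the components of $T-e$ containing $u$ and $v$, respectively, and put $\mu(e)=\min\{n_u(e),n_v(e)\}$. For $1\le i\le\lfloor n/2\rfloor$ let $r_i(T)$ be the number of edges $e$ of $T$ with $\mu(e)=i$. For trees $T,T'$ on $n$ vertices write $T\preceq T'$ if $$\sum_{i=k}^{\lfloor n/2\rfloor} r_i(T)\le\sum_{i=k}^{\lfloor n/2\rfloor} r_i(T')\qquad\text{for every } k=1,2,\ldots,\lfloor n/2\rfloor .$$ Let $CP_{n;1,\Delta-1}$ be the tree obtained from a path $v_1v_2\cdots v_{n-\Delta}$ by attaching one pendant vertex to $v_1$ and $\Delta-1$ pendant vertices to $v_{n-\Delta}$. Then $CP_{n;1,\Delta-1}\in\mathcal{T}_n^{\Delta}$, and every $T\in\mathcal{T}_n^{\Delta}$ satisfies $$T\preceq CP_{n;1,\Delta-1}.$$ Moreover, equality holds, i.e. $r_i(T)=r_i(CP_{n;1,\Delta-1})$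 for all $1\le i\le\lfloor n/2\rfloor$, if and only if $T$ is isomorphic to $CP_{n;1,\Delta-1}$. -/

import Mathlib

namespace EdgeDivision

universe u v

/-- `n_u(e)` for the edge `e = uv`: the number of vertices of the component of `T - e`
that contains `u`. -/
noncomputable def sideCard {V : Type u} (T : SimpleGraph V) (x y : V) : ℕ :=
  ((T.deleteEdges {s(x, y)}).connectedComponentMk x).supp.ncard

/-- `μ(e) = min {n_u(e), n_v(e)}` for `e = uv`. -/
noncomputable def mu {V : Type u} (T : SimpleGraph V) : Sym2 V → ℕ :=
  Sym2.lift ⟨fun x y => min (sideCard T x y) (sideCard T y x), fun _ _ => min_comm _ _⟩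

/-- `r_i(T)`, the number of edges `e` of `T` with `μ(e) = i`. -/
noncomputable def r {V : Type u} (T : SimpleGraph V) (i : ℕ) : ℕ :=
  {e : Sym2 V | e ∈ T.edgeSet ∧ mu T e = i}.ncard

/-- `T ⪯ T'` for trees `T`, `T'` on `n` vertices (on possibly different vertex types):
`∑_{i=k}^{⌊n/2⌋} r_i(T) ≤ ∑_{i=k}^{⌊n/2⌋} r_i(T')` for every `k = 1, …, ⌊n/2⌋`. -/
def Preceq {V : Type u} {W : Type v} (n : ℕ) (T : SimpleGraph V) (T' : SimpleGraph W) : Prop :=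
  ∀ k ∈ Finset.Icc 1 (n / 2),
    ∑ i ∈ Finset.Icc k (n / 2), r T i ≤ ∑ i ∈ Finset.Icc k (n / 2), r T' i

/-- `T ≈ T'` for trees `T`, `T'` on `n` vertices: the edge division vectors
`(r_1, …, r_{⌊n/2⌋})` of `T` and `T'` are equal. -/
def SameVector {V : Type u} {W : Type v} (n : ℕ) (T : SimpleGraph V) (T' : SimpleGraph W) :
    Prop :=
  ∀ i ∈ Finset.Icc 1 (n / 2), r T i = r T' i

open Classical in
/-- `T` belongs to the class of trees on `n` vertices with maximum degree `Δ`. -/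
structure IsTreeOfMaxDegree {V : Type u} [Fintype V] (n Δ : ℕ) (T : SimpleGraph V) : Prop where
  isTree : T.IsTree
  card_eq : Fintype.card V = n
  maxDegree_eq : T.maxDegree = Δ

/-- The double star path `CP_{n;a,b}`: the path `v_0 ⋯ v_{k-1}` on `k = n - (a + b)` vertices,
with `a` pendant vertices attached to its first vertex `v_0` and `b` pendant vertices attached to
its last vertex `v_{k-1}`. -/
def doubleStarPath (n a b : ℕ) : SimpleGraph (Fin (n - (a + b)) ⊕ (Fin a ⊕ Fin b)) :=
  SimpleGraph.fromRel fun x y =>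
    match x, y with
    | .inl i, .inl j => i.val + 1 = j.val
    | .inr (.inl _), .inl j => j.val = 0
    | .inr (.inr _), .inl j => j.val + 1 = n - (a + b)
    | _, _ => False

end EdgeDivision

/-! The sum of the `r_i` over `i ≥ j` counts the edges with `μ ≥ j` (`tailCount`), so a bound on
that sum is a lower bound on the number of small edges, those with `μ < j`. Suppose `xy` has `μ ≥ j
≥ 2`. Each of its two sides contains at least `j - 1` small edges (`le_ncard_sideEdges_mu_lt`),
which gives `2j - 2`. Alternatively, let `c` have degree `Δ`: at least `Δ - 1` branches at `c` avoid
the side of `xy` not containing `c`, and each supplies its own pendant edge, which gives `Δ - 1 + j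
- 1`. As there are `n - 1` edges, at most `n + 1 - max j Δ - j` are large (`tailCount_le`).
`CP_{n;1,Δ-1}` attains this bound for every `j ≥ 2`, and for `j = 1` all edges count.

In the equality case only `r_1 = Δ` and `r_2 = 1` are used. A tree with at most `Δ` leaves and a
vertex `c` of degree `Δ ≥ 3` has all other degrees at most 2, so it is a spider. Each leaf not
adjacent to `c` yields its own edge with `μ = 2`, so at most one leg is longer than 1
(`exists_isBroomHeight_of_r_le`). A height function then determines the tree up to isomorphism. -/

namespace EdgeDivision

/-! ### Components of a tree minus one edge -/

section Side

variable {V : Type*}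

/-- The vertex set of the component of `T - xy` that contains `x`. -/
def side (T : SimpleGraph V) (x y : V) : Set V :=
  {v | (T.deleteEdges {s(x, y)}).Reachable x v}

variable {T : SimpleGraph V} {x y a b v w : V}

theorem supp_connectedComponentMk_deleteEdges (T : SimpleGraph V) (x y : V) :
    ((T.deleteEdges {s(x, y)}).connectedComponentMk x).supp = side T x y := by
  ext v
  simp only [SimpleGraph.ConnectedComponent.mem_supp_iff, SimpleGraph.ConnectedComponent.eq, side,
    Set.mem_ofPred_eq]
  exact ⟨fun h => h.symm, fun h => h.symm⟩

theorem sideCard_eq_ncard_side (T : SimpleGraph V) (x y : V) :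
    sideCard T x y = (side T x y).ncard := by
  rw [sideCard, supp_connectedComponentMk_deleteEdges]

theorem mu_mk (T : SimpleGraph V) (x y : V) :
    mu T s(x, y) = min (sideCard T x y) (sideCard T y x) := rfl

theorem self_mem_side (T : SimpleGraph V) (x y : V) : x ∈ side T x y :=
  SimpleGraph.Reachable.refl _

theorem side_adj (hv : v ∈ side T x y) (h : T.Adj v w) (hne : s(v, w) ≠ s(x, y)) :
    w ∈ side T x y :=
  SimpleGraph.Reachable.trans hv
    (SimpleGraph.Adj.reachable (SimpleGraph.deleteEdges_adj.2 ⟨h, hne⟩))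

theorem mem_of_reachable_of_closed {G : SimpleGraph V} {C : Set V} (hx : x ∈ C)
    (hC : ∀ ⦃u w⦄, u ∈ C → G.Reachable x u → G.Adj u w → w ∈ C) (hv : G.Reachable x v) :
    v ∈ C := by
  have h := (SimpleGraph.reachable_iff_reflTransGen _ _).1 hv
  induction h with
  | refl => exact hx
  | tail h1 h2 ih =>
    have hr := (SimpleGraph.reachable_iff_reflTransGen _ _).2 h1
    exact hC (ih hr) hr h2

theorem side_subset_of_closed {C : Set V} (hx : x ∈ C)
    (hC : ∀ ⦃u w⦄, u ∈ C → T.Adj u w → s(u, w) ≠ s(x, y) → w ∈ C) : side T x y ⊆ C := by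
  intro v hv
  refine mem_of_reachable_of_closed hx (fun u w hu _ huw => ?_) hv
  rw [SimpleGraph.deleteEdges_adj] at huw
  exact hC hu huw.1 huw.2

/-- A walk from `a` that avoids the edge `ab` stays in `side T a b`. Since that set misses an end of
`xy`, the walk never uses `xy` and cannot leave `side T x y`. -/
theorem side_subset_side_of_start_mem (ha : a ∈ side T x y)
    (h : x ∉ side T a b ∨ y ∉ side T a b) : side T a b ⊆ side T x y := by
  intro v hv
  refine mem_of_reachable_of_closed ha (fun u w hu hr huw => ?_) hv
  have hw : w ∈ side T a b := SimpleGraph.Reachable.trans hr huw.reachable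
  have hu' : u ∈ side T a b := hr
  rw [SimpleGraph.deleteEdges_adj] at huw
  refine side_adj hu huw.1 fun he => ?_
  rcases Sym2.eq_iff.1 he with ⟨rfl, rfl⟩ | ⟨rfl, rfl⟩ <;> tauto

/-- The same argument with the walk run backwards, from the common vertex `v` to `a`. -/
theorem start_mem_side (hva : v ∈ side T a b) (hvx : v ∈ side T x y)
    (h : x ∉ side T a b ∨ y ∉ side T a b) : a ∈ side T x y := by
  have hr : (T.deleteEdges {s(a, b)}).Reachable v a := SimpleGraph.Reachable.symm hva
  refine mem_of_reachable_of_closed hvx (fun u w hu hr' huw => ?_) hr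
  have hu' : u ∈ side T a b := SimpleGraph.Reachable.trans hva hr'
  have hw : w ∈ side T a b := SimpleGraph.Reachable.trans hu' huw.reachable
  rw [SimpleGraph.deleteEdges_adj] at huw
  refine side_adj hu huw.1 fun he => ?_
  rcases Sym2.eq_iff.1 he with ⟨rfl, rfl⟩ | ⟨rfl, rfl⟩ <;> tauto

theorem side_subset_side (hva : v ∈ side T a b) (hvx : v ∈ side T x y)
    (h : x ∉ side T a b ∨ y ∉ side T a b) : side T a b ⊆ side T x y :=
  side_subset_side_of_start_mem (start_mem_side hva hvx h) h

theorem end_notMem_side (hT : T.IsTree) (h : T.Adj x y) : y ∉ side T x y := by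
  have := SimpleGraph.isAcyclic_iff_forall_adj_isBridge.1 hT.isAcyclic h
  rw [SimpleGraph.isBridge_iff] at this
  exact this

theorem mem_side_or (hT : T.Connected) (x y v : V) : v ∈ side T x y ∨ v ∈ side T y x := by
  refine mem_of_reachable_of_closed (G := T) (C := {v | v ∈ side T x y ∨ v ∈ side T y x})
    (Or.inl (self_mem_side T x y)) (fun u w hu _ huw => ?_) (hT.preconnected x v)
  by_cases he : s(u, w) = s(x, y)
  · rcases Sym2.eq_iff.1 he with ⟨rfl, rfl⟩ | ⟨rfl, rfl⟩
    · exact Or.inr (self_mem_side _ _ _)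
    · exact Or.inl (self_mem_side _ _ _)
  · exact hu.imp (fun h => side_adj h huw he)
      (fun h => side_adj h huw (by rwa [Sym2.eq_swap (a := y)]))

theorem disjoint_side (hT : T.IsTree) (h : T.Adj x y) : Disjoint (side T x y) (side T y x) := by
  rw [Set.disjoint_left]
  intro v hv hv'
  exact end_notMem_side hT h.symm
    (start_mem_side hv hv' (Or.inl (end_notMem_side hT h)))

theorem side_symm_eq_compl (hT : T.IsTree) (h : T.Adj x y) : side T y x = (side T x y)ᶜ := by
  ext v
  have h1 := mem_side_or hT.connected x y v
  have h2 : v ∈ side T x y → v ∉ side T y x := fun hv =>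
    Set.disjoint_left.1 (disjoint_side hT h) hv
  simp only [Set.mem_compl_iff]
  tauto

theorem sideCard_add [Finite V] (hT : T.IsTree) (h : T.Adj x y) :
    sideCard T x y + sideCard T y x = Nat.card V := by
  rw [sideCard_eq_ncard_side, sideCard_eq_ncard_side, side_symm_eq_compl hT h,
    Set.ncard_add_ncard_compl]

theorem one_le_sideCard [Finite V] (T : SimpleGraph V) (x y : V) : 1 ≤ sideCard T x y := by
  rw [sideCard_eq_ncard_side]
  exact (Set.ncard_pos (Set.toFinite _)).2 ⟨x, self_mem_side T x y⟩

theorem disjoint_side_of_ne (hT : T.IsTree) {c : V} (hv : T.Adj v c) (hw : T.Adj w c)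
    (hne : v ≠ w) : Disjoint (side T v c) (side T w c) := by
  rw [Set.disjoint_left]
  intro u hu hu'
  have h1 := start_mem_side hu hu' (Or.inr (end_notMem_side hT hv))
  refine end_notMem_side hT hw (side_adj h1 hv fun he => ?_)
  rcases Sym2.eq_iff.1 he with ⟨h, _⟩ | ⟨h, _⟩
  · exact hne h
  · exact hv.ne h

/-- The edges of `T` with both ends in the component of `T - xy` that contains `x`. -/
def sideEdges (T : SimpleGraph V) (x y : V) : Set (Sym2 V) :=
  {e | e ∈ T.edgeSet ∧ ∀ v ∈ e, v ∈ side T x y}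

theorem sideCard_le_ncard_sideEdges_add_one [Finite V] (T : SimpleGraph V) (x y : V) :
    sideCard T x y ≤ (sideEdges T x y).ncard + 1 := by
  set C := (T.deleteEdges {s(x, y)}).connectedComponentMk x with hC
  have h1 := C.connected_toSimpleGraph.card_vert_le_card_edgeSet_add_one
  have h2 : Nat.card C = sideCard T x y := by
    rw [sideCard, ← hC, ← Nat.card_coe_set_eq]; rfl
  have h3 : Nat.card C.toSimpleGraph.edgeSet ≤ (sideEdges T x y).ncard := by
    rw [Nat.card_coe_set_eq]
    refine Set.ncard_le_ncard_of_injOn (Sym2.map Subtype.val) ?_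
      (Sym2.map.injective Subtype.val_injective).injOn (Set.toFinite _)
    intro e
    induction e using Sym2.ind with
    | _ u w =>
    intro he
    have hadj : (T.deleteEdges {s(x, y)}).Adj u.1 w.1 := he
    have hs : ∀ z : C, z.1 ∈ side T x y := fun z => by
      rw [← supp_connectedComponentMk_deleteEdges]; exact z.2
    refine ⟨(SimpleGraph.deleteEdges_adj.1 hadj).1, ?_⟩
    intro z hz
    simp only [Sym2.map_mk, Sym2.mem_iff] at hz
    rcases hz with rfl | rfl <;> exact hs _
  omega

/-- Induction on the size of the side. An edge `ab` inside it with `μ ≥ j` cuts off, away from `x`,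
a strictly smaller side that still has at least `j` vertices. If there is no such edge, all edges
inside are small, and a connected graph on at least `j` vertices has at least `j - 1` edges. -/
theorem le_ncard_sideEdges_mu_lt [Finite V] (hT : T.IsTree) {j : ℕ} :
    ∀ {x y : V}, T.Adj x y → j ≤ sideCard T x y →
      j ≤ {e ∈ sideEdges T x y | mu T e < j}.ncard + 1 := by
  suffices H : ∀ m : ℕ, ∀ x y : V, sideCard T x y = m → T.Adj x y → j ≤ sideCard T x y →
      j ≤ {e ∈ sideEdges T x y | mu T e < j}.ncard + 1 from
    fun {x y} h1 h2 => H _ x y rfl h1 h2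
  intro m
  induction m using Nat.strong_induction_on with
  | _ m ih =>
  intro x y hm hxy hj
  by_cases hbig : ∃ a b, s(a, b) ∈ sideEdges T x y ∧ j ≤ mu T s(a, b) ∧ x ∈ side T b a
  · obtain ⟨a, b, hab, hmu, hx⟩ := hbig
    have hadj : T.Adj a b := hab.1
    have hx' : x ∉ side T a b := fun h => Set.disjoint_left.1 (disjoint_side hT hadj) h hx
    have ha : a ∈ side T x y := hab.2 a (Sym2.mem_mk_left _ _)
    have hb : b ∈ side T x y := hab.2 b (Sym2.mem_mk_right _ _)
    have hsub := side_subset_side_of_start_mem ha (b := b) (Or.inl hx')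
    have hlt : sideCard T a b < m := by
      rw [← hm, sideCard_eq_ncard_side, sideCard_eq_ncard_side]
      exact Set.ncard_lt_ncard ⟨hsub, fun h => end_notMem_side hT hadj (h hb)⟩ (Set.toFinite _)
    have := ih _ hlt a b rfl hadj (hmu.trans (min_le_left _ _))
    refine this.trans (Nat.add_le_add_right (Set.ncard_le_ncard ?_ (Set.toFinite _)) 1)
    rintro e ⟨⟨he, hs⟩, hl⟩
    exact ⟨⟨he, fun v hv => hsub (hs v hv)⟩, hl⟩
  · have : {e ∈ sideEdges T x y | mu T e < j} = sideEdges T x y := by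
      refine Set.sep_eq_self_iff_mem_true.2 fun e he => ?_
      by_contra hcon
      rw [not_lt] at hcon
      induction e using Sym2.ind with
      | _ a b =>
      rcases mem_side_or hT.connected a b x with h | h
      · rw [Sym2.eq_swap] at he hcon
        exact hbig ⟨b, a, he, hcon, h⟩
      · exact hbig ⟨a, b, he, hcon, h⟩
    rw [this]
    exact hj.trans (sideCard_le_ncard_sideEdges_add_one T x y)

end Side

/-! ### Counting edges with large `μ`: the upper bound -/

section Counting

universe u v

variable {V : Type u} {W : Type v}

theorem sideCard_le_of_iso [Finite V] [Finite W] {T : SimpleGraph V} {T' : SimpleGraph W}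
    (f : T ≃g T') (x y : V) : sideCard T x y ≤ sideCard T' (f x) (f y) := by
  rw [sideCard_eq_ncard_side, sideCard_eq_ncard_side]
  refine Set.ncard_le_ncard_of_injOn f ?_ f.injective.injOn (Set.toFinite _)
  intro v hv
  have h := side_subset_of_closed (T := T) (x := x) (y := y)
    (C := {v | f v ∈ side T' (f x) (f y)}) (self_mem_side T' (f x) (f y))
    (fun u w hu huw hne => side_adj hu (f.map_adj_iff.2 huw) fun he => hne ?_)
  · exact h hv
  · apply Sym2.map.injective f.injective
    simpa using he

theorem sideCard_iso [Finite V] [Finite W] {T : SimpleGraph V} {T' : SimpleGraph W}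
    (f : T ≃g T') (x y : V) : sideCard T' (f x) (f y) = sideCard T x y := by
  refine le_antisymm ?_ (sideCard_le_of_iso f x y)
  simpa using sideCard_le_of_iso f.symm (f x) (f y)

theorem mu_iso [Finite V] [Finite W] {T : SimpleGraph V} {T' : SimpleGraph W}
    (f : T ≃g T') (e : Sym2 V) : mu T' (e.map f) = mu T e := by
  induction e using Sym2.ind with
  | _ x y => simp [mu_mk, sideCard_iso]

theorem r_le_of_iso [Finite V] [Finite W] {T : SimpleGraph V} {T' : SimpleGraph W}
    (f : T ≃g T') (i : ℕ) : r T i ≤ r T' i := by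
  refine Set.ncard_le_ncard_of_injOn (Sym2.map f) ?_ (Sym2.map.injective f.injective).injOn
    (Set.toFinite _)
  rintro e ⟨he, hm⟩
  refine ⟨?_, by rw [mu_iso, hm]⟩
  induction e using Sym2.ind with
  | _ x y => exact f.map_adj_iff.2 he

theorem r_iso [Finite V] [Finite W] {T : SimpleGraph V} {T' : SimpleGraph W}
    (f : T ≃g T') (i : ℕ) : r T i = r T' i :=
  le_antisymm (r_le_of_iso f i) (r_le_of_iso f.symm i)

/-- The number of edges `e` of `T` with `j ≤ μ(e)`. -/
noncomputable def tailCount (T : SimpleGraph V) (j : ℕ) : ℕ :=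
  {e : Sym2 V | e ∈ T.edgeSet ∧ j ≤ mu T e}.ncard

variable [Finite V] {T : SimpleGraph V}

theorem two_mul_mu_le (hT : T.IsTree) {e : Sym2 V} (he : e ∈ T.edgeSet) :
    2 * mu T e ≤ Nat.card V := by
  induction e using Sym2.ind with
  | _ x y =>
    have := sideCard_add hT (show T.Adj x y from he)
    rw [mu_mk]
    omega

theorem one_le_mu (T : SimpleGraph V) (e : Sym2 V) : 1 ≤ mu T e := by
  induction e using Sym2.ind with
  | _ x y => exact le_min (one_le_sideCard T x y) (one_le_sideCard T y x)

theorem tailCount_eq_r_add (T : SimpleGraph V) (j : ℕ) :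
    tailCount T j = r T j + tailCount T (j + 1) := by
  rw [tailCount, r, tailCount, ← Set.ncard_union_eq _ (Set.toFinite _) (Set.toFinite _)]
  · congr 1
    ext e
    simp only [Set.mem_union, Set.mem_ofPred_eq]
    constructor
    · rintro ⟨h, h'⟩
      rcases h'.eq_or_lt with h' | h'
      · exact Or.inl ⟨h, h'.symm⟩
      · exact Or.inr ⟨h, h'⟩
    · rintro (⟨h, h'⟩ | ⟨h, h'⟩)
      · exact ⟨h, h'.ge⟩
      · exact ⟨h, by omega⟩
  · rw [Set.disjoint_left]
    rintro e ⟨_, h⟩ ⟨_, h'⟩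
    omega

theorem tailCount_eq_zero (hT : T.IsTree) {j : ℕ} (hj : Nat.card V / 2 < j) :
    tailCount T j = 0 := by
  rw [tailCount, Set.ncard_eq_zero (Set.toFinite _), Set.eq_empty_iff_forall_notMem]
  rintro e ⟨he, h⟩
  have := two_mul_mu_le hT he
  omega

theorem sum_r_eq_tailCount (hT : T.IsTree) (k : ℕ) :
    ∑ i ∈ Finset.Icc k (Nat.card V / 2), r T i = tailCount T k := by
  rcases lt_or_ge (Nat.card V / 2) k with hk | hk
  · rw [Finset.Icc_eq_empty_of_lt hk, Finset.sum_empty, tailCount_eq_zero hT hk]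
  · induction hk using Nat.decreasingInduction with
    | self =>
      rw [Finset.Icc_self, Finset.sum_singleton, tailCount_eq_r_add,
        tailCount_eq_zero hT (Nat.lt_succ_self _), add_zero]
    | of_succ k hk ih =>
      rw [tailCount_eq_r_add, ← ih, ← Finset.add_sum_Ioc_eq_sum_Icc (by omega)]
      congr 2
      ext i
      simp

theorem ncard_edgeSet_add_one (hT : T.IsTree) : T.edgeSet.ncard + 1 = Nat.card V := by
  have := (SimpleGraph.isTree_iff_connected_and_card.1 hT).2
  rwa [Nat.card_coe_set_eq] at this

theorem tailCount_one_add_one (hT : T.IsTree) : tailCount T 1 + 1 = Nat.card V := by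
  rw [← ncard_edgeSet_add_one hT, tailCount]
  congr 2
  ext e
  simp [one_le_mu]

theorem tailCount_add (hT : T.IsTree) (j : ℕ) :
    tailCount T j + {e : Sym2 V | e ∈ T.edgeSet ∧ mu T e < j}.ncard + 1 = Nat.card V := by
  rw [← ncard_edgeSet_add_one hT, tailCount,
    ← Set.ncard_union_eq _ (Set.toFinite _) (Set.toFinite _)]
  · congr 2
    ext e
    simp only [Set.mem_union, Set.mem_ofPred_eq]
    have := le_or_gt j (mu T e)
    tauto
  · rw [Set.disjoint_left]
    rintro e ⟨_, h⟩ ⟨_, h'⟩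
    omega

/-- Every branch at `c` provides a pendant edge: `wc` itself if the branch is a single vertex,
otherwise an edge inside it, by the case `j = 2` of `le_ncard_sideEdges_mu_lt`. The first case is
why `c` may be an end of `e`. -/
theorem exists_mu_lt_two_of_branch (hT : T.IsTree) {w c : V} (h : T.Adj w c) :
    ∃ e ∈ T.edgeSet, mu T e < 2 ∧ (∃ v ∈ e, v ∈ side T w c) ∧
      ∀ v ∈ e, v ∈ side T w c ∨ v = c := by
  rcases lt_or_ge (sideCard T w c) 2 with h2 | h2
  · refine ⟨s(w, c), h, (min_le_left _ _).trans_lt h2,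
      ⟨w, Sym2.mem_mk_left _ _, self_mem_side T w c⟩, ?_⟩
    intro v hv
    rcases Sym2.mem_iff.1 hv with rfl | rfl
    · exact Or.inl (self_mem_side _ _ _)
    · exact Or.inr rfl
  · have := le_ncard_sideEdges_mu_lt hT h h2
    have hne : {e ∈ sideEdges T w c | mu T e < 2}.Nonempty := by
      rw [← Set.ncard_pos (Set.toFinite _)]
      omega
    obtain ⟨e, ⟨he, hs⟩, hl⟩ := hne
    refine ⟨e, he, hl, ?_, fun v hv => Or.inl (hs v hv)⟩
    induction e using Sym2.ind with
    | _ a b => exact ⟨a, Sym2.mem_mk_left _ _, hs a (Sym2.mem_mk_left _ _)⟩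

theorem two_mul_le_ncard_mu_lt (hT : T.IsTree) {j : ℕ} {x y : V} (h : T.Adj x y)
    (hj : j ≤ mu T s(x, y)) :
    2 * j ≤ {e : Sym2 V | e ∈ T.edgeSet ∧ mu T e < j}.ncard + 2 := by
  have h1 := le_ncard_sideEdges_mu_lt hT h (hj.trans (min_le_left _ _))
  have h2 := le_ncard_sideEdges_mu_lt hT h.symm (hj.trans (min_le_right _ _))
  have h3 : {e ∈ sideEdges T x y | mu T e < j}.ncard + {e ∈ sideEdges T y x | mu T e < j}.ncard ≤
      {e : Sym2 V | e ∈ T.edgeSet ∧ mu T e < j}.ncard := by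
    rw [← Set.ncard_union_eq _ (Set.toFinite _) (Set.toFinite _)]
    · refine Set.ncard_le_ncard ?_ (Set.toFinite _)
      rintro e (⟨⟨he, _⟩, hl⟩ | ⟨⟨he, _⟩, hl⟩) <;> exact ⟨he, hl⟩
    · rw [Set.disjoint_left]
      rintro e ⟨⟨_, hs⟩, _⟩ ⟨⟨_, hs'⟩, _⟩
      induction e using Sym2.ind with
      | _ a b =>
        exact Set.disjoint_left.1 (disjoint_side hT h) (hs a (Sym2.mem_mk_left _ _))
          (hs' a (Sym2.mem_mk_left _ _))
  omega

theorem degree_add_le_ncard_mu_lt (hT : T.IsTree) {j : ℕ} (hj2 : 2 ≤ j) (c : V) {x y : V}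
    (h : T.Adj x y) (hj : j ≤ mu T s(x, y)) :
    (T.neighborSet c).ncard + j ≤ {e : Sym2 V | e ∈ T.edgeSet ∧ mu T e < j}.ncard + 2 := by
  wlog hc : c ∈ side T y x generalizing x y
  · exact this h.symm (by rwa [Sym2.eq_swap])
      ((mem_side_or hT.connected x y c).resolve_right hc)
  have hc' : c ∉ side T x y := fun h' => Set.disjoint_left.1 (disjoint_side hT h) h' hc
  have h1 := le_ncard_sideEdges_mu_lt hT h (hj.trans (min_le_left _ _))
  -- The branches at `c` that do not contain `x`. Distinct branches are disjoint, so at most one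
  -- neighbour of `c` is lost.
  set B : Set V := {w | T.Adj c w ∧ x ∉ side T w c} with hB
  have hBcard : (T.neighborSet c).ncard ≤ B.ncard + 1 := by
    have hsub : (T.neighborSet c \ B).ncard ≤ 1 := by
      rw [Set.ncard_le_one (Set.toFinite _)]
      rintro a ⟨ha, ha'⟩ b ⟨hb, hb'⟩
      have ha : T.Adj c a := ha
      have hb : T.Adj c b := hb
      by_contra hne
      have hxa : x ∈ side T a c := by by_contra hcon; exact ha' ⟨ha, hcon⟩
      have hxb : x ∈ side T b c := by by_contra hcon; exact hb' ⟨hb, hcon⟩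
      exact Set.disjoint_left.1 (disjoint_side_of_ne hT ha.symm hb.symm hne) hxa hxb
    have := Set.ncard_le_ncard_sdiff_add_ncard (T.neighborSet c) B (Set.toFinite _)
    omega
  have hex : ∀ w : V, ∃ e : Sym2 V, w ∈ B → (e ∈ T.edgeSet ∧ mu T e < 2 ∧
      (∃ v ∈ e, v ∈ side T w c) ∧ ∀ v ∈ e, v ∈ side T w c ∨ v = c) := fun w => by
    by_cases hw : w ∈ B
    · obtain ⟨e, he⟩ := exists_mu_lt_two_of_branch hT hw.1.symm
      exact ⟨e, fun _ => he⟩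
    · exact ⟨s(w, w), fun h => absurd h hw⟩
  choose f hf using hex
  have hinj : Set.InjOn f B := by
    intro a ha b hb hab
    by_contra hne
    obtain ⟨-, -, ⟨v, hv, hva⟩, -⟩ := hf a ha
    rw [hab] at hv
    rcases (hf b hb).2.2.2 v hv with hvb | rfl
    · exact Set.disjoint_left.1 (disjoint_side_of_ne hT ha.1.symm hb.1.symm hne) hva hvb
    · exact end_notMem_side hT ha.1.symm hva
  have h3 : (f '' B).ncard + {e ∈ sideEdges T x y | mu T e < j}.ncard ≤
      {e : Sym2 V | e ∈ T.edgeSet ∧ mu T e < j}.ncard := by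
    rw [← Set.ncard_union_eq _ (Set.toFinite _) (Set.toFinite _)]
    · refine Set.ncard_le_ncard ?_ (Set.toFinite _)
      rintro e (⟨w, hw, rfl⟩ | ⟨⟨he, _⟩, hl⟩)
      · exact ⟨(hf w hw).1, (hf w hw).2.1.trans_le hj2⟩
      · exact ⟨he, hl⟩
    · rw [Set.disjoint_left]
      rintro _ ⟨w, hw, rfl⟩ ⟨⟨_, hs⟩, _⟩
      obtain ⟨-, -, ⟨v, hv, hvw⟩, -⟩ := hf w hw
      -- A pendant edge meeting the side of `x` would put `x` in the branch of `w`, because `c` is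
      -- not in that side.
      exact hw.2 (start_mem_side (hs v hv) hvw (Or.inr hc'))
  rw [hinj.ncard_image] at h3
  omega

/-- The truncated subtraction is harmless: if no edge has `μ ≥ j` the left side is 0, and otherwise
such an edge triggers both lower bounds on the number of small edges. -/
theorem tailCount_le (hT : T.IsTree) (c : V) {j : ℕ} (hj : 2 ≤ j) :
    tailCount T j ≤ Nat.card V + 1 - max j (T.neighborSet c).ncard - j := by
  rcases Set.eq_empty_or_nonempty {e : Sym2 V | e ∈ T.edgeSet ∧ j ≤ mu T e} with h0 | ⟨e, he, hm⟩
  · rw [tailCount, h0, Set.ncard_empty]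
    exact Nat.zero_le _
  · induction e using Sym2.ind with
    | _ x y =>
    have h1 := two_mul_le_ncard_mu_lt hT he hm
    have h2 := degree_add_le_ncard_mu_lt hT hj c he hm
    have h3 := tailCount_add hT j
    omega

end Counting

/-! ### Brooms described by heights; the bound is attained -/

section Broom

universe u v

/-- `p` is a height function that shows `G` to be a path with vertices at heights `0, …, k` whose
end at height `k` carries pendant vertices, all at height `k + 1`. -/
structure IsBroomHeight {W : Type u} (G : SimpleGraph W) (k : ℕ) (p : W → ℕ) : Prop where
  adj_iff : ∀ x y, G.Adj x y ↔ p x + 1 = p y ∨ p y + 1 = p x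
  le : ∀ x, p x ≤ k + 1
  surj : ∀ m ≤ k + 1, ∃ x, p x = m
  inj : ∀ x y, p x = p y → p x ≤ k → x = y

theorem ncard_neighborSet {V : Type u} (T : SimpleGraph V) (v : V) [Fintype (T.neighborSet v)] :
    (T.neighborSet v).ncard = T.degree v := by
  rw [← SimpleGraph.card_neighborSet_eq_degree, ← Nat.card_coe_set_eq, Nat.card_eq_fintype_card]

namespace IsBroomHeight

variable {W : Type u} {G : SimpleGraph W} {k : ℕ} {p : W → ℕ}

theorem isTree (h : IsBroomHeight G k p) : G.IsTree := by
  obtain ⟨o, ho⟩ := h.surj 0 (Nat.zero_le _)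
  have hreach : ∀ m : ℕ, ∀ v, p v = m → G.Reachable v o := by
    intro m
    induction m with
    | zero =>
      intro v hv
      rw [h.inj v o (by omega) (by omega)]
    | succ m ih =>
      intro v hv
      obtain ⟨u, hu⟩ := h.surj m (by have := h.le v; omega)
      exact SimpleGraph.Reachable.trans
        ((h.adj_iff v u).2 (Or.inr (by omega))).reachable (ih u hu)
  have : Nonempty W := ⟨o⟩
  refine ⟨⟨fun a b => (hreach _ a rfl).trans (hreach _ b rfl).symm⟩, ?_⟩
  rw [SimpleGraph.isAcyclic_iff_forall_adj_isBridge]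
  have key : ∀ x y, p x + 1 = p y → G.IsBridge s(x, y) := by
    intro x y hxy
    rw [SimpleGraph.isBridge_iff]
    intro hr
    have hr' : y ∈ side G x y := hr
    -- Vertices level with `y` must be allowed: if `p y = k + 1`, the other pendant vertices lie on
    -- the side of `x`.
    have hsub : side G x y ⊆ {z | z ≠ y ∧ p z ≤ p y} := by
      refine side_subset_of_closed ⟨fun he => by rw [he] at hxy; omega, by omega⟩ ?_
      rintro a b ⟨ha, ha'⟩ hab hne
      have hle := h.le b
      have hyl := h.le y
      rcases (h.adj_iff a b).1 hab with e | e
      · refine ⟨?_, ?_⟩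
        · rintro rfl
          exact hne (by rw [h.inj a x (by omega) (by omega)])
        · by_contra hcon
          exact ha (h.inj a y (by omega) (by omega))
      · refine ⟨?_, by omega⟩
        rintro rfl
        omega
    exact (hsub hr').1 rfl
  intro x y hxy
  rcases (h.adj_iff x y).1 hxy with e | e
  · exact key x y e
  · rw [Sym2.eq_swap]
    exact key y x e

theorem ncard_lt [Finite W] (h : IsBroomHeight G k p) {i : ℕ} (hi : i ≤ k + 1) :
    {x | p x < i}.ncard = i := by
  have hinj : Set.InjOn p {x | p x < i} := fun x hx y _ hxy =>
    h.inj x y hxy (by have : p x < i := hx; omega)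
  rw [← hinj.ncard_image]
  have : p '' {x | p x < i} = Set.Iio i := by
    ext m
    simp only [Set.mem_image, Set.mem_ofPred_eq, Set.mem_Iio]
    constructor
    · rintro ⟨x, hx, rfl⟩
      exact hx
    · intro hm
      obtain ⟨x, hx⟩ := h.surj m (by omega)
      exact ⟨x, by omega, hx⟩
  rw [this, Set.ncard_eq_toFinset_card']
  simp

theorem ncard_top [Finite W] (h : IsBroomHeight G k p) :
    {x | p x = k + 1}.ncard + (k + 1) = Nat.card W := by
  have h1 := Set.ncard_add_ncard_compl {x | p x < k + 1}
  have h2 : {x | p x < k + 1}ᶜ = {x | p x = k + 1} := by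
    ext x
    have := h.le x
    simp only [Set.mem_compl_iff, Set.mem_ofPred_eq]
    omega
  rw [h.ncard_lt le_rfl, h2] at h1
  omega

/-- Adjacency depends only on heights, so any height-preserving bijection is an isomorphism. The
fibres agree in size: singletons up to `k`, and the remaining vertices at `k + 1`. -/
theorem nonempty_iso {W' : Type v} {G' : SimpleGraph W'} {p' : W' → ℕ} [Finite W] [Finite W']
    (h : IsBroomHeight G k p) (h' : IsBroomHeight G' k p') (hc : Nat.card W = Nat.card W') :
    Nonempty (G ≃g G') := by
  have hfib : ∀ m, Nonempty ({x // p x = m} ≃ {x // p' x = m}) := by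
    intro m
    refine Finite.card_eq.1 ?_
    rcases lt_trichotomy m (k + 1) with hm | rfl | hm
    · obtain ⟨x, hx⟩ := h.surj m hm.le
      obtain ⟨x', hx'⟩ := h'.surj m hm.le
      have e1 : Nat.card {x // p x = m} = 1 := Nat.card_eq_one_iff_unique.2
        ⟨⟨fun a b => Subtype.ext (h.inj _ _ (a.2.trans b.2.symm) (by have := a.2; omega))⟩,
          ⟨x, hx⟩⟩
      have e2 : Nat.card {x // p' x = m} = 1 := Nat.card_eq_one_iff_unique.2
        ⟨⟨fun a b => Subtype.ext (h'.inj _ _ (a.2.trans b.2.symm) (by have := a.2; omega))⟩,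
          ⟨x', hx'⟩⟩
      rw [e1, e2]
    · have e1 := h.ncard_top
      have e2 := h'.ncard_top
      rw [← Nat.card_coe_set_eq] at e1 e2
      have : Nat.card {x | p x = k + 1} = Nat.card {x | p' x = k + 1} := by omega
      exact this
    · have i1 : IsEmpty {x // p x = m} := ⟨fun a => by have := a.2; have := h.le a.1; omega⟩
      have i2 : IsEmpty {x // p' x = m} := ⟨fun a => by have := a.2; have := h'.le a.1; omega⟩
      rw [Nat.card_of_isEmpty, Nat.card_of_isEmpty]
  let g := fun m => (hfib m).some
  let f : W ≃ W' := (Equiv.sigmaFiberEquiv p).symm.trans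
    ((Equiv.sigmaCongrRight g).trans (Equiv.sigmaFiberEquiv p'))
  have hf : ∀ x, p' (f x) = p x := fun x => (g (p x) ⟨x, rfl⟩).2
  exact ⟨⟨f, fun {a b} => by rw [h'.adj_iff, h.adj_iff, hf, hf]⟩⟩

theorem ncard_neighborSet_center [Finite W] (h : IsBroomHeight G k p) (hk : 1 ≤ k) {c : W}
    (hc : p c = k) : (G.neighborSet c).ncard + k = Nat.card W := by
  obtain ⟨d, hd⟩ := h.surj (k - 1) (by omega)
  have : G.neighborSet c = insert d {x | p x = k + 1} := by
    ext x
    simp only [SimpleGraph.mem_neighborSet, h.adj_iff, Set.mem_insert_iff, Set.mem_ofPred_eq]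
    constructor
    · rintro (e | e)
      · right; omega
      · left; exact h.inj x d (by omega) (by omega)
    · rintro (rfl | e)
      · right; omega
      · left; omega
  rw [this, Set.ncard_insert_of_notMem (fun e => by have : p d = k + 1 := e; omega)
    (Set.toFinite _)]
  have := h.ncard_top
  omega

theorem ncard_neighborSet_le_two [Finite W] (h : IsBroomHeight G k p) {v : W} (hv : p v ≠ k) :
    (G.neighborSet v).ncard ≤ 2 := by
  have hmem : ∀ x ∈ G.neighborSet v, p v + 1 = p x ∨ p x + 1 = p v := fun x hx =>
    (h.adj_iff v x).1 hx
  calc (G.neighborSet v).ncard ≤ ({p v - 1, p v + 1} : Set ℕ).ncard := by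
        refine Set.ncard_le_ncard_of_injOn p ?_ ?_ (Set.toFinite _)
        · intro x hx
          have := hmem x hx
          simp only [Set.mem_insert_iff, Set.mem_singleton_iff]
          omega
        · intro x hx y _ hxy
          have := hmem x hx
          have := h.le x
          have := h.le v
          exact h.inj x y hxy (by omega)
    _ ≤ 2 := (Set.ncard_insert_le _ _).trans (by rw [Set.ncard_singleton])

theorem isTreeOfMaxDegree [Fintype W] (h : IsBroomHeight G k p) (hk : 1 ≤ k) {n Δ : ℕ}
    (hn : Fintype.card W = n) (hΔ : Δ + k = n) (h2 : 2 ≤ Δ) : IsTreeOfMaxDegree n Δ G := by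
  classical
  obtain ⟨c, hc⟩ := h.surj k (by omega)
  have hcard := h.ncard_neighborSet_center hk hc
  rw [Nat.card_eq_fintype_card, hn] at hcard
  refine ⟨h.isTree, hn, le_antisymm (SimpleGraph.maxDegree_le_of_forall_degree_le _ _ ?_) ?_⟩
  · intro v
    rw [← ncard_neighborSet]
    by_cases hv : p v = k
    · rw [h.inj v c (by omega) (by omega)]
      omega
    · exact (h.ncard_neighborSet_le_two hv).trans h2
  · refine le_trans ?_ (SimpleGraph.degree_le_maxDegree _ c)
    rw [← ncard_neighborSet]
    omega

/-- Cutting a path edge separates exactly the vertices below `y`, one at each height `0, …, p y -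
1`. -/
theorem sideCard_eq [Finite W] (h : IsBroomHeight G k p) {x y : W} (hxy : p x + 1 = p y)
    (hy : p y ≤ k) : sideCard G x y = p y := by
  have hadj : G.Adj x y := (h.adj_iff x y).2 (Or.inl hxy)
  have key : ∀ a b, G.Adj a b → s(a, b) ≠ s(x, y) → p a < p y → p b < p y := by
    intro a b hab hne ha
    rcases (h.adj_iff a b).1 hab with e | e
    · by_contra hcon
      exact hne (by rw [h.inj a x (by omega) (by omega), h.inj b y (by omega) (by omega)])
    · omega
  have h1 : side G x y ⊆ {z | p z < p y} :=
    side_subset_of_closed (show p x < p y by omega) fun a b ha hab hne => key a b hab hne ha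
  have h2 : side G y x ⊆ {z | p z < p y}ᶜ :=
    side_subset_of_closed (show ¬ p y < p y by omega) fun a b ha hab hne hb =>
      ha (key b a hab.symm (by rwa [Sym2.eq_swap, Sym2.eq_swap (a := x)]) hb)
  rw [side_symm_eq_compl h.isTree hadj, Set.compl_subset_compl] at h2
  rw [sideCard_eq_ncard_side, h1.antisymm h2, h.ncard_lt (by omega)]

theorem le_tailCount [Finite W] (h : IsBroomHeight G k p) {j : ℕ} (hj : 2 ≤ j) :
    Nat.card W + 1 - max j (Nat.card W - k) - j ≤ tailCount G j := by
  have hk := h.ncard_top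
  have : Nonempty W := h.isTree.connected.nonempty
  choose! q hq using h.surj
  -- The path edge between heights `i - 1` and `i` has sides of sizes `i` and `Nat.card W - i`; both
  -- are at least `j` exactly for `j ≤ i ≤ Nat.card W - j`, and `i ≤ k` keeps the edge on the path.
  have hcard : (Finset.Icc j (min (Nat.card W - j) k)).card = min (Nat.card W - j) k + 1 - j :=
    Nat.card_Icc _ _
  have : (Finset.Icc j (min (Nat.card W - j) k) : Set ℕ).ncard ≤ tailCount G j := by
    refine Set.ncard_le_ncard_of_injOn (fun i => s(q (i - 1), q i)) ?_ ?_ (Set.toFinite _)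
    · intro i hi
      rw [Finset.coe_Icc, Set.mem_Icc] at hi
      have h1 := hq i (by omega)
      have h2 := hq (i - 1) (by omega)
      have hadj : G.Adj (q (i - 1)) (q i) := (h.adj_iff _ _).2 (Or.inl (by omega))
      have h3 := h.sideCard_eq (x := q (i - 1)) (y := q i) (by omega) (by omega)
      have h4 := sideCard_add h.isTree hadj
      have h5 : j ≤ sideCard G (q (i - 1)) (q i) := by omega
      have h6 : j ≤ sideCard G (q i) (q (i - 1)) := by omega
      exact ⟨hadj, le_min h5 h6⟩
    · intro i hi i' hi' he
      rw [Finset.coe_Icc, Set.mem_Icc] at hi hi'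
      have h1 := hq i (by omega)
      have h2 := hq (i - 1) (by omega)
      have h1' := hq i' (by omega)
      have h2' := hq (i' - 1) (by omega)
      rcases Sym2.eq_iff.1 he with ⟨e1, e2⟩ | ⟨e1, e2⟩
      · rw [e2] at h1; omega
      · rw [e1] at h2; rw [e2] at h1; omega
  rw [Set.ncard_coe_finset, hcard] at this
  omega

theorem tailCount_eq [Finite W] (h : IsBroomHeight G k p) (hk : 1 ≤ k) {j : ℕ} (hj : 2 ≤ j) :
    tailCount G j = Nat.card W + 1 - max j (Nat.card W - k) - j := by
  refine le_antisymm ?_ (h.le_tailCount hj)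
  obtain ⟨c, hc⟩ := h.surj k (by omega)
  have h1 := tailCount_le h.isTree c hj
  have h2 := h.ncard_neighborSet_center hk hc
  omega

end IsBroomHeight

/-- The height function of `CP_{n;1,b}`. -/
def doubleStarPathHeight (n b : ℕ) : Fin (n - (1 + b)) ⊕ (Fin 1 ⊕ Fin b) → ℕ
  | .inl i => i.val + 1
  | .inr (.inl _) => 0
  | .inr (.inr _) => n - (1 + b) + 1

theorem isBroomHeight_doubleStarPath {n b : ℕ} (hb : 1 ≤ b) (hn : 1 + b < n) :
    IsBroomHeight (doubleStarPath n 1 b) (n - (1 + b)) (doubleStarPathHeight n b) where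
  adj_iff := by
    rintro (i | i | i) (j | j | j) <;> (have hi := i.isLt; have hj := j.isLt) <;>
      simp [doubleStarPath, doubleStarPathHeight, Fin.ext_iff] <;> omega
  le := by
    rintro (i | i | i) <;> simp only [doubleStarPathHeight] <;> omega
  surj := by
    intro m hm
    rcases Nat.eq_zero_or_pos m with rfl | h0
    · exact ⟨.inr (.inl 0), rfl⟩
    · rcases hm.eq_or_lt with rfl | h1
      · exact ⟨.inr (.inr ⟨0, hb⟩), rfl⟩
      · exact ⟨.inl ⟨m - 1, by omega⟩, by simp only [doubleStarPathHeight]; omega⟩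
  inj := by
    rintro (i | i | i) (j | j | j) <;> (have hi := i.isLt; have hj := j.isLt) <;>
      simp [doubleStarPathHeight, Fin.ext_iff] <;> omega

end Broom

/-! ### Equality case: recovering the broom from `r_1` and `r_2` -/

section Uniqueness

universe u

variable {V : Type u} {T : SimpleGraph V}

theorem exists_adj_dist_add_one (hT : T.Connected) {c v : V} (hv : v ≠ c) :
    ∃ u, T.Adj u v ∧ T.dist c u + 1 = T.dist c v := by
  obtain ⟨q, hq⟩ := hT.exists_walk_length_eq_dist v c
  cases q with
  | nil => exact absurd rfl hv
  | cons h q =>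
    rename_i u
    refine ⟨u, h.symm, ?_⟩
    have h1 := SimpleGraph.dist_le q
    have h2 := hT.dist_triangle (u := c) (v := u) (w := v)
    rw [SimpleGraph.dist_eq_one_iff_adj.2 h.symm] at h2
    rw [SimpleGraph.dist_comm (u := u)] at h1
    rw [SimpleGraph.dist_comm (u := v)] at hq
    rw [SimpleGraph.Walk.length_cons] at hq
    omega

theorem eq_of_adj_of_ncard_eq_one {a b v : V} (h1 : (T.neighborSet v).ncard = 1)
    (ha : T.Adj v a) (hb : T.Adj v b) : a = b := by
  obtain ⟨z, hz⟩ := Set.ncard_eq_one.1 h1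
  have ha' : a ∈ T.neighborSet v := ha
  have hb' : b ∈ T.neighborSet v := hb
  rw [hz, Set.mem_singleton_iff] at ha' hb'
  rw [ha', hb']

theorem sideCard_of_leaf {u v : V} (h : T.Adj v u) (h1 : (T.neighborSet v).ncard = 1) :
    sideCard T v u = 1 := by
  have : side T v u = {v} := by
    refine Set.Subset.antisymm (side_subset_of_closed rfl ?_)
      (Set.singleton_subset_iff.2 (self_mem_side T v u))
    rintro a b rfl hab hne
    exact absurd (by rw [eq_of_adj_of_ncard_eq_one h1 hab h]) hne
  rw [sideCard_eq_ncard_side, this, Set.ncard_singleton]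

theorem sum_ncard_neighborSet_add_two (hT : T.IsTree) [Fintype V] :
    ∑ v, (T.neighborSet v).ncard + 2 = 2 * Nat.card V := by
  classical
  have h1 := T.sum_degrees_eq_twice_card_edges
  have h2 := hT.card_edgeFinset
  simp only [ncard_neighborSet, Nat.card_eq_fintype_card]
  omega

theorem exists_parent_notMem {c : V} {L : Set V} (hT : T.IsTree)
    (hL : ∀ v ∈ L, T.Adj c v ∧ (T.neighborSet v).ncard = 1) {v : V} (hvc : v ≠ c) :
    ∃ u, u ∉ L ∧ T.Adj u v ∧ T.dist c u + 1 = T.dist c v := by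
  obtain ⟨u, hu, hd⟩ := exists_adj_dist_add_one hT.connected hvc
  exact ⟨u, fun h => hvc (eq_of_adj_of_ncard_eq_one (hL u h).2 hu (hL u h).1.symm), hu, hd⟩

variable [Finite V]

theorem one_le_ncard_neighborSet (hT : T.IsTree) (hn : 2 ≤ Nat.card V) (v : V) :
    1 ≤ (T.neighborSet v).ncard := by
  have : Nontrivial V := Finite.one_lt_card_iff_nontrivial.1 hn
  rw [Nat.one_le_iff_ne_zero, ← Nat.pos_iff_ne_zero, Set.ncard_pos (Set.toFinite _)]
  obtain ⟨w, hw⟩ := hT.connected.preconnected.exists_adj_of_nontrivial v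
  exact ⟨w, hw⟩

theorem ncard_leaves_le_r_one (hT : T.IsTree) (hn : 3 ≤ Nat.card V) :
    {v | (T.neighborSet v).ncard = 1}.ncard ≤ r T 1 := by
  have hex : ∀ v, ∃ u, T.Adj v u := fun v => by
    have h := one_le_ncard_neighborSet hT (by omega) v
    exact (Set.ncard_pos (Set.toFinite _)).1 h
  choose nb hnb using hex
  refine Set.ncard_le_ncard_of_injOn (fun v => s(v, nb v)) ?_ ?_ (Set.toFinite _)
  · intro v hv
    refine ⟨hnb v, ?_⟩
    rw [mu_mk, sideCard_of_leaf (hnb v) hv, min_eq_left (one_le_sideCard T _ _)]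
  · intro v hv w hw he
    rcases Sym2.eq_iff.1 he with ⟨h, -⟩ | ⟨h, h'⟩
    · exact h
    · have h1 := sideCard_of_leaf (hnb v) hv
      have h2 := sideCard_of_leaf (hnb w) hw
      have h3 := sideCard_add hT (hnb v)
      rw [← h] at h2
      rw [h'] at h1 h3
      omega

/-- Degree sum: the values `deg v - 2` add up to `-2`. Leaves contribute `-1` each, so they must pay
for the excess degrees of `c` and `x`. -/
theorem add_le_ncard_leaves_add (hT : T.IsTree) (hn : 2 ≤ Nat.card V) {c x : V} (hx : x ≠ c)
    (hc : 2 ≤ (T.neighborSet c).ncard) :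
    (T.neighborSet c).ncard + (T.neighborSet x).ncard ≤
      {v | (T.neighborSet v).ncard = 1}.ncard + 2 := by
  classical
  have := Fintype.ofFinite V
  have hs := sum_ncard_neighborSet_add_two hT
  have hl : {v | (T.neighborSet v).ncard = 1}.ncard =
      ∑ v, if (T.neighborSet v).ncard = 1 then 1 else 0 := by
    rw [Set.ncard_eq_toFinset_card', Finset.sum_boole]
    simp
  have key : ∑ v, (2 + (if v = c then (T.neighborSet c).ncard - 2 else 0) +
        if v = x then (T.neighborSet x).ncard - 2 else 0) ≤
      ∑ v, ((T.neighborSet v).ncard + if (T.neighborSet v).ncard = 1 then 1 else 0) := by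
    refine Finset.sum_le_sum fun v _ => ?_
    have := one_le_ncard_neighborSet hT hn v
    by_cases h1 : v = c
    · subst h1
      rw [if_pos rfl, if_neg hx.symm]
      split_ifs <;> omega
    · by_cases h2 : v = x
      · subst h2
        rw [if_neg h1, if_pos rfl]
        split_ifs <;> omega
      · rw [if_neg h1, if_neg h2]
        split_ifs <;> omega
  simp only [Finset.sum_add_distrib, Finset.sum_const, Finset.card_univ, smul_eq_mul,
    Finset.sum_ite_eq', Finset.mem_univ, if_true] at key
  rw [Nat.card_eq_fintype_card] at hs
  omega

/-- The neighbour `u` of such a leaf `v` has degree exactly 2, so its other edge `uz` cuts off `{v,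
u}`. With at least 5 vertices the opposite side is larger, so `μ = 2` and the edge determines `v`.
-/
theorem ncard_far_leaves_le_r_two (hT : T.IsTree) (hn : 5 ≤ Nat.card V) {c : V}
    (h2 : ∀ x, x ≠ c → (T.neighborSet x).ncard ≤ 2) :
    {v | (T.neighborSet v).ncard = 1 ∧ ¬ T.Adj c v}.ncard ≤ r T 2 := by
  have hex : ∀ v, ∃ e : V × V, (T.neighborSet v).ncard = 1 ∧ ¬ T.Adj c v →
      T.Adj e.1 e.2 ∧ side T e.1 e.2 = {v, e.1} ∧ v ≠ e.1 := by
    intro v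
    by_cases hv : (T.neighborSet v).ncard = 1 ∧ ¬ T.Adj c v
    swap
    · exact ⟨(v, v), fun h => absurd h hv⟩
    obtain ⟨u, hvu⟩ : ∃ u, T.Adj v u :=
      (Set.ncard_pos (Set.toFinite _)).1 (show 0 < (T.neighborSet v).ncard by omega)
    have huc : u ≠ c := by
      rintro rfl
      exact hv.2 hvu.symm
    have hu1 : (T.neighborSet u).ncard ≠ 1 := by
      intro h
      have e1 := sideCard_of_leaf hvu hv.1
      have e2 := sideCard_of_leaf hvu.symm h
      have e3 := sideCard_add hT hvu
      omega
    have hu2 : (T.neighborSet u).ncard = 2 := by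
      have := one_le_ncard_neighborSet hT (by omega) u
      have := h2 u huc
      omega
    obtain ⟨z, hz, hzv⟩ := Set.exists_ne_of_one_lt_ncard (by omega : 1 < (T.neighborSet u).ncard) v
    have hnb : T.neighborSet u = {v, z} := by
      symm
      refine Set.eq_of_subset_of_ncard_le ?_ ?_ (Set.toFinite _)
      · rintro w (rfl | rfl)
        · exact hvu.symm
        · exact hz
      · rw [hu2, Set.ncard_pair hzv.symm]
    refine ⟨(u, z), fun _ => ⟨hz, ?_, hvu.ne⟩⟩
    apply Set.Subset.antisymm
    · refine side_subset_of_closed (Or.inr rfl) ?_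
      rintro a b (rfl | rfl) hab hne
      · exact Or.inr (eq_of_adj_of_ncard_eq_one hv.1 hab hvu)
      · have : b ∈ T.neighborSet a := hab
        rw [hnb] at this
        rcases this with rfl | rfl
        · exact Or.inl rfl
        · exact absurd rfl hne
    · rintro w (rfl | rfl)
      · refine side_adj (self_mem_side T u z) hvu.symm fun he => ?_
        rcases Sym2.eq_iff.1 he with ⟨-, h⟩ | ⟨h, -⟩
        · exact hzv h.symm
        · exact (show T.Adj u z from hz).ne h
      · exact self_mem_side _ _ _
  choose f hf using hex
  have hcard : ∀ v, (T.neighborSet v).ncard = 1 ∧ ¬ T.Adj c v →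
      sideCard T (f v).1 (f v).2 = 2 := fun v hv => by
    rw [sideCard_eq_ncard_side, (hf v hv).2.1, Set.ncard_pair (hf v hv).2.2]
  refine Set.ncard_le_ncard_of_injOn (fun v => s((f v).1, (f v).2)) ?_ ?_ (Set.toFinite _)
  · intro v hv
    have h1 := hcard v hv
    have h3 := sideCard_add hT (hf v hv).1
    refine ⟨(hf v hv).1, ?_⟩
    rw [mu_mk, h1, min_eq_left]
    omega
  · intro v hv w hw he
    rcases Sym2.eq_iff.1 he with ⟨h, h'⟩ | ⟨h, h'⟩
    · have h1 := (hf v hv).2.1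
      rw [h, h', (hf w hw).2.1] at h1
      have : v ∈ ({w, (f w).1} : Set V) := h1 ▸ Or.inl rfl
      exact this.resolve_right fun h4 => (hf v hv).2.2 (h4.trans h.symm)
    · have h1 := hcard v hv
      have h3 := hcard w hw
      have h4 := sideCard_add hT (hf v hv).1
      rw [h1, h, h', h3] at h4
      omega

/-! ### The height function read off from distances to `c` -/

section Height

variable {c : V} {L : Set V}

/-- Outside `L` the tree does not branch when one moves away from `c`: `c` has at most one neighbour
there, and any other vertex has at most one besides its parent. -/
theorem eq_of_dist_eq (hT : T.IsTree)
    (hL : ∀ v ∈ L, T.Adj c v ∧ (T.neighborSet v).ncard = 1)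
    (h1 : (T.neighborSet c \ L).ncard ≤ 1) (h2 : ∀ x, x ≠ c → (T.neighborSet x).ncard ≤ 2) :
    ∀ m : ℕ, ∀ v w, v ∉ L → w ∉ L → T.dist c v = m → T.dist c w = m → v = w := by
  intro m
  induction m with
  | zero =>
    intro v w _ _ hv hw
    rw [hT.connected.dist_eq_zero_iff] at hv hw
    rw [← hv, ← hw]
  | succ m ih =>
    intro v w hvL hwL hv hw
    have hne : ∀ z, T.dist c z = m + 1 → z ≠ c := by
      rintro z hz rfl
      rw [SimpleGraph.dist_self] at hz
      omega
    obtain ⟨u, huL, huv, hdu⟩ := exists_parent_notMem hT hL (hne v hv)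
    obtain ⟨u', huL', huw, hdu'⟩ := exists_parent_notMem hT hL (hne w hw)
    obtain rfl := ih u u' huL huL' (by omega) (by omega)
    by_cases huc : u = c
    · subst huc
      exact (Set.ncard_le_one (Set.toFinite _)).1 h1 v ⟨huv, hvL⟩ w ⟨huw, hwL⟩
    · obtain ⟨z, -, hzu, hdz⟩ := exists_parent_notMem hT hL huc
      by_contra hvw
      have hsub : ({z, v, w} : Set V) ⊆ T.neighborSet u := by
        rintro a (rfl | rfl | rfl)
        exacts [hzu.symm, huv, huw]
      have hle := Set.ncard_le_ncard hsub (Set.toFinite _)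
      rw [Set.ncard_insert_of_notMem _ (Set.toFinite _), Set.ncard_pair hvw] at hle
      · have := h2 u huc
        omega
      · rintro (rfl | rfl) <;> omega

theorem exists_isBroomHeight (hT : T.IsTree) (hc : c ∉ L)
    (hL : ∀ v ∈ L, T.Adj c v ∧ (T.neighborSet v).ncard = 1)
    (h1 : (T.neighborSet c \ L).ncard ≤ 1) (h2 : ∀ x, x ≠ c → (T.neighborSet x).ncard ≤ 2)
    (hne : L.Nonempty) {k : ℕ} (hk : Lᶜ.ncard = k + 1) : ∃ p : V → ℕ, IsBroomHeight T k p := by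
  classical
  -- Distances from `c` are injective on `Lᶜ` and their image is closed downwards, so having `k + 1`
  -- vertices forces the image to be `0, …, k`.
  have hinj : Set.InjOn (T.dist c) Lᶜ := fun v hv w hw h =>
    eq_of_dist_eq hT hL h1 h2 _ v w hv hw rfl h.symm
  have hdown : ∀ d : ℕ, ∀ v, v ∉ L → T.dist c v = d →
      Set.Iic d ⊆ T.dist c '' Lᶜ := by
    intro d
    induction d with
    | zero =>
      intro v hv hd m hm
      exact ⟨v, hv, by have : m ≤ 0 := hm; omega⟩
    | succ d ih =>
      intro v hv hd m hm
      rcases (show m ≤ d + 1 from hm).eq_or_lt with rfl | hlt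
      · exact ⟨v, hv, hd⟩
      · have hvc : v ≠ c := by
          rintro rfl
          rw [SimpleGraph.dist_self] at hd
          omega
        obtain ⟨u, hu, -, hdu⟩ := exists_parent_notMem hT hL hvc
        exact ih u hu (by omega) (show m ≤ d by omega)
  have hcardIic : ∀ d : ℕ, (Set.Iic d).ncard = d + 1 := fun d => by
    rw [Set.ncard_eq_toFinset_card']
    simp
  have hle : ∀ v, v ∉ L → T.dist c v ≤ k := by
    intro v hv
    have := Set.ncard_le_ncard (hdown _ v hv rfl) (Set.toFinite _)
    rw [hcardIic, hinj.ncard_image, hk] at this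
    omega
  have himg : T.dist c '' Lᶜ = Set.Iic k := by
    refine Set.eq_of_subset_of_ncard_le ?_ ?_ (Set.toFinite _)
    · rintro _ ⟨v, hv, rfl⟩
      exact hle v hv
    · rw [hcardIic, hinj.ncard_image, hk]
  have hadjL : ∀ v ∈ L, ∀ w, T.Adj v w ↔ w = c := fun v hv w =>
    ⟨fun h => eq_of_adj_of_ncard_eq_one (hL v hv).2 h (hL v hv).1.symm,
      fun h => h ▸ (hL v hv).1.symm⟩
  have hd0 : ∀ w, w = c ↔ T.dist c w = 0 := fun w => by
    rw [hT.connected.dist_eq_zero_iff, eq_comm]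
  have hadjD : ∀ v w, v ∉ L → w ∉ L → T.dist c v = T.dist c w + 1 → T.Adj w v := by
    intro v w hv hw hd
    obtain ⟨u, hu, huv, hdu⟩ :=
      exists_parent_notMem hT hL (fun h => by have := (hd0 v).1 h; omega)
    rwa [hinj hw hu (by omega)]
  -- Distances are reversed so that `c` gets height `k` and the far end of the path height 0.
  refine ⟨fun v => if v ∈ L then k + 1 else k - T.dist c v, ?_, ?_, ?_, ?_⟩
  · intro v w
    by_cases hv : v ∈ L <;> by_cases hw : w ∈ L
    · rw [if_pos hv, if_pos hw, hadjL v hv]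
      exact ⟨fun h => absurd (h ▸ hw) hc, fun h => by omega⟩
    · rw [if_pos hv, if_neg hw, hadjL v hv, hd0]
      have := hle w hw
      omega
    · rw [if_neg hv, if_pos hw, T.adj_comm, hadjL w hw, hd0]
      have := hle v hv
      omega
    · rw [if_neg hv, if_neg hw]
      have h3 := hle v hv
      have h4 := hle w hw
      constructor
      · intro h
        have := hT.dist_eq_dist_add_one_of_adj c h
        omega
      · rintro (h | h)
        · exact (hadjD v w hv hw (by omega)).symm
        · exact hadjD w v hw hv (by omega)
  · intro v
    split_ifs <;> omega
  · intro m hm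
    rcases hm.eq_or_lt with rfl | hlt
    · obtain ⟨v, hv⟩ := hne
      exact ⟨v, if_pos hv⟩
    · have : k - m ∈ T.dist c '' Lᶜ := himg ▸ (show k - m ≤ k by omega)
      obtain ⟨v, hv, hd⟩ := this
      exact ⟨v, by rw [if_neg hv, hd]; omega⟩
  · intro v w h hl
    by_cases hv : v ∈ L
    · rw [if_pos hv] at hl
      omega
    by_cases hw : w ∈ L
    · rw [h, if_pos hw] at hl
      omega
    rw [if_neg hv, if_neg hw] at h
    have h3 := hle v hv
    have h4 := hle w hw
    exact hinj hv hw (by omega)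

end Height

theorem exists_isBroomHeight_of_r_le (hT : T.IsTree) {c : V} {k : ℕ}
    (hc : 3 ≤ (T.neighborSet c).ncard) (hk : (T.neighborSet c).ncard + k = Nat.card V)
    (hk2 : 2 ≤ k) (hr1 : r T 1 ≤ (T.neighborSet c).ncard) (hr2 : r T 2 ≤ 1) :
    ∃ p : V → ℕ, IsBroomHeight T k p := by
  have hleaf := ncard_leaves_le_r_one hT (by omega)
  have h2 : ∀ x, x ≠ c → (T.neighborSet x).ncard ≤ 2 := fun x hx => by
    have := add_le_ncard_leaves_add hT (by omega) hx (by omega)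
    omega
  have hfar := ncard_far_leaves_le_r_two hT (by omega) h2
  have hnear : (T.neighborSet c).ncard - 1 ≤
      {v | T.Adj c v ∧ (T.neighborSet v).ncard = 1}.ncard := by
    have hmany : (T.neighborSet c).ncard ≤ {v | (T.neighborSet v).ncard = 1}.ncard := by
      by_cases hx : ∃ x, x ≠ c ∧ 2 ≤ (T.neighborSet x).ncard
      · obtain ⟨x, hxc, hx⟩ := hx
        have := add_le_ncard_leaves_add hT (by omega) hxc (by omega)
        omega
      · have hsub : ({c} : Set V)ᶜ ⊆ {v | (T.neighborSet v).ncard = 1} := by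
          intro x hxc
          have := one_le_ncard_neighborSet hT (by omega) x
          by_contra hcon
          exact hx ⟨x, hxc, by have : ¬ (T.neighborSet x).ncard = 1 := hcon; omega⟩
        have h3 := Set.ncard_le_ncard hsub (Set.toFinite _)
        have h4 := Set.ncard_add_ncard_compl ({c} : Set V)
        rw [Set.ncard_singleton] at h4
        omega
    have hcover : {v | (T.neighborSet v).ncard = 1} ⊆
        {v | T.Adj c v ∧ (T.neighborSet v).ncard = 1} ∪
          {v | (T.neighborSet v).ncard = 1 ∧ ¬ T.Adj c v} := by
      intro v hv
      by_cases h : T.Adj c v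
      · exact Or.inl ⟨h, hv⟩
      · exact Or.inr ⟨hv, h⟩
    have h3 := Set.ncard_le_ncard hcover (Set.toFinite _)
    have h4 := Set.ncard_union_le {v | T.Adj c v ∧ (T.neighborSet v).ncard = 1}
      {v | (T.neighborSet v).ncard = 1 ∧ ¬ T.Adj c v}
    omega
  -- Exactly `deg c - 1` leaves are taken, so that `c` keeps one neighbour outside `L` and `Lᶜ` has
  -- `k + 1` vertices.
  obtain ⟨L, hLsub, hLcard⟩ := Set.exists_subset_card_eq hnear
  refine exists_isBroomHeight (c := c) (L := L) hT (fun h => (hLsub h).1.ne rfl) hLsub ?_ h2 ?_ ?_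
  · have hsub : L ⊆ T.neighborSet c := fun v hv => (hLsub hv).1
    rw [Set.ncard_sdiff hsub (Set.toFinite _)]
    omega
  · rw [← Set.ncard_pos (Set.toFinite _)]
    omega
  · have := Set.ncard_add_ncard_compl L
    omega

end Uniqueness

end EdgeDivision

/-! ### The main theorem -/

theorem mainTheorem6 (n Δ : ℕ) (h₂ : 2 < Δ) (hn : Δ < n - 1) :
    EdgeDivision.IsTreeOfMaxDegree n Δ (EdgeDivision.doubleStarPath n 1 (Δ - 1)) ∧
    ∀ (V : Type*) [Fintype V] (T : SimpleGraph V), EdgeDivision.IsTreeOfMaxDegree n Δ T →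
      EdgeDivision.Preceq n T (EdgeDivision.doubleStarPath n 1 (Δ - 1)) ∧
      (EdgeDivision.SameVector n T (EdgeDivision.doubleStarPath n 1 (Δ - 1)) ↔
        Nonempty (T ≃g EdgeDivision.doubleStarPath n 1 (Δ - 1))) := by
  open EdgeDivision in
  classical
  have hB := isBroomHeight_doubleStarPath (n := n) (b := Δ - 1) (by omega) (by omega)
  have hcard : Nat.card (Fin (n - (1 + (Δ - 1))) ⊕ (Fin 1 ⊕ Fin (Δ - 1))) = n := by
    simp only [Nat.card_eq_fintype_card, Fintype.card_sum, Fintype.card_fin]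
    omega
  have htail := fun j hj => hB.tailCount_eq (by omega) (j := j) hj
  rw [hcard, show n - (n - (1 + (Δ - 1))) = Δ by omega] at htail
  have hBtree := hB.isTree
  have hB1 := tailCount_one_add_one hBtree
  rw [hcard] at hB1
  refine ⟨hB.isTreeOfMaxDegree (by omega) (by rw [← Nat.card_eq_fintype_card, hcard]) (by omega)
    (by omega), ?_⟩
  intro V _ T hT
  have hV : Nat.card V = n := by rw [Nat.card_eq_fintype_card, hT.card_eq]
  have hne : Nonempty V := hT.isTree.connected.nonempty
  obtain ⟨c, hc⟩ : ∃ c, (T.neighborSet c).ncard = Δ := by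
    obtain ⟨c, hc⟩ := T.exists_maximal_degree_vertex
    refine ⟨c, ?_⟩
    rw [ncard_neighborSet, ← hc]
    convert hT.maxDegree_eq
  refine ⟨?_, ?_, ?_⟩
  · intro k hk
    have e1 := sum_r_eq_tailCount hT.isTree k
    have e2 := sum_r_eq_tailCount hBtree k
    rw [hV] at e1
    rw [hcard] at e2
    rw [e1, e2]
    rcases (Finset.mem_Icc.1 hk).1.eq_or_lt with rfl | hk2
    · have := tailCount_one_add_one hT.isTree
      omega
    · have h3 := tailCount_le hT.isTree c hk2
      have h4 := htail k hk2
      rw [hV, hc] at h3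
      omega
  · intro hsame
    -- Both indices are in range because `n ≥ 5`. Differences of the tail counts at 1, 2, 3 give
    -- `r_1 = Δ` and `r_2 = 1` for the broom, hence for `T`.
    have s1 := hsame 1 (Finset.mem_Icc.2 ⟨le_rfl, by omega⟩)
    have s2 := hsame 2 (Finset.mem_Icc.2 ⟨by omega, by omega⟩)
    have t1 := tailCount_eq_r_add (doubleStarPath n 1 (Δ - 1)) 1
    have t2 := tailCount_eq_r_add (doubleStarPath n 1 (Δ - 1)) 2
    have b2 := htail 2 le_rfl
    have b3 := htail 3 (by omega)
    rw [show max 2 Δ = Δ by omega] at b2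
    rw [show max 3 Δ = Δ by omega] at b3
    norm_num at t1 t2
    obtain ⟨p, hp⟩ := exists_isBroomHeight_of_r_le (c := c) (k := n - (1 + (Δ - 1))) hT.isTree
      (by omega) (by omega) (by omega) (by omega) (by omega)
    exact hp.nonempty_iso hB (by rw [hV, hcard])
  · rintro ⟨f⟩ i -
    exact r_iso f i
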